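/- A triangular family is a family $\mathcal Z=\{z_{n,j}\}_{n\ge 0,\;0\le j\le m_n}$ of points of the unit circle $\mathbb T$, where $m_n\ge 0$ are integers. For $1\le p<\infty$ it is called a Marcinkiewicz–Zygmund (M-Z) family for $L^p$ if there is a constant $C>0$ such that for all $n\ge 1$ and all holomorphic polynomials $q$ of degree at most $n$ \[ \frac{C^{-1}}{m_n}\sum_{j=0}^{m_n}|q(z_{n,j})|^p\le\int_0^{2\pi}|q(e^{i\theta})|^p\,d\theta\le\frac{C}{m_n}\sum_{j=0}^{m_n}|q(z_{n,j})|^p \] (in particular $m_n\ge 1$ for $n\ge 1$). It is called an M-Z family for $L^\infty$ if there is a constant $C>0$ such that $\sup_{|z|=1}|q(z)|\le C\max_{0\le j\le m_n}|q(z_{n,j})|$ for all $n\ge 0$ and all polynomials $q$ of degree at most $n$. A triangular family is separated if there is an $\varepsilon>0$ such that $|z_{n,j}-z_{n,k}|\ge\varepsilon/n$ for all $n\ge1$ and all $0\le j,k\le m_n$ with $j\ne k$. A triangular subfamily of $\mathcal Z$ is a triangular family $\mathcal Z'$ whose $n$-th generation $z'_{n,0},\dots,z'_{n,m'_n}$ is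 obtained, for every $n$, by selecting some of the members (with distinct indices) of the $n$-th generation $z_{n,0},\dots,z_{n,m_n}$ of $\mathcal Z$. Theorem. Let $1\le p\le\infty$. If $\mathcal Z$ is an M-Z family for $L^p$, then there is a separated triangular subfamily $\mathcal Z'$ of $\mathcal Z$ that is also an M-Z family for $L^p$. -/

import Mathlib

open scoped ENNReal

/-- A triangular family of points `z_{n,j}` of the unit circle, with `n = 0, 1, 2, …` and
`j = 0, …, m_n`. Repetitions inside a generation are allowed. -/
structure TriangularFamily where
  /-- The last index `m_n` of the `n`-th generation, which is `z_{n,0}, …, z_{n,m_n}`. -/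
  m : ℕ → ℕ
  /-- The points `z_{n,j}`. -/
  point : (n : ℕ) → Fin (m n + 1) → Circle

namespace TriangularFamily

/-- The Marcinkiewicz-Zygmund inequalities for a finite exponent `p`, with a constant
independent of the polynomial `q` and of the degree bound `n`. The generation `n = 0`, where
`m_n` may be zero and `q` is constant, carries no condition. For `n ≥ 1` the second inequality
with `q = 1` excludes `m_n = 0`. -/
def IsMZFinite (Z : TriangularFamily) (p : ℝ) : Prop :=
  ∃ C : ℝ, 0 < C ∧ ∀ n : ℕ, 1 ≤ n → ∀ q : Polynomial ℂ, q.natDegree ≤ n →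
    C⁻¹ / (Z.m n : ℝ) * ∑ j, ‖q.eval (Z.point n j : ℂ)‖ ^ p
        ≤ ∫ θ in (0 : ℝ)..(2 * Real.pi), ‖q.eval (Circle.exp θ : ℂ)‖ ^ p ∧
      ∫ θ in (0 : ℝ)..(2 * Real.pi), ‖q.eval (Circle.exp θ : ℂ)‖ ^ p
        ≤ C / (Z.m n : ℝ) * ∑ j, ‖q.eval (Z.point n j : ℂ)‖ ^ p

/-- The Marcinkiewicz-Zygmund inequality for the exponent `∞`. -/
def IsMZInfinite (Z : TriangularFamily) : Prop :=
  ∃ C : ℝ, 0 < C ∧ ∀ n : ℕ, ∀ q : Polynomial ℂ, q.natDegree ≤ n →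
    (⨆ z : Circle, ‖q.eval (z : ℂ)‖) ≤ C * ⨆ j, ‖q.eval (Z.point n j : ℂ)‖

/-- `Z` is a Marcinkiewicz-Zygmund family for `L^p` (meant for `1 ≤ p ≤ ∞`). -/
def IsMZFamily (Z : TriangularFamily) (p : ℝ≥0∞) : Prop :=
  (p ≠ ∞ → Z.IsMZFinite p.toReal) ∧ (p = ∞ → Z.IsMZInfinite)

/-- `Z` is separated: `|z_{n,j} - z_{n,k}| ≥ ε / n` for `j ≠ k` and `n ≥ 1`. -/
def IsSeparated (Z : TriangularFamily) : Prop :=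
  ∃ ε : ℝ, 0 < ε ∧ ∀ n : ℕ, 1 ≤ n → ∀ j k : Fin (Z.m n + 1), j ≠ k →
    ε / (n : ℝ) ≤ ‖(Z.point n j : ℂ) - (Z.point n k : ℂ)‖

/-- `W` is a triangular subfamily of `Z`: every generation of `W` is obtained from the
generation of `Z` with the same index by selecting some of its members. -/
def IsSubfamily (W Z : TriangularFamily) : Prop :=
  ∀ n : ℕ, ∃ σ : Fin (W.m n + 1) → Fin (Z.m n + 1), Function.Injective σ ∧
    ∀ j, W.point n j = Z.point n (σ j)

end TriangularFamily

/-! A maximal `δ / n`-separated part of the `n`-th generation is also `δ / n`-dense in it, and for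
small `δ` it keeps the sampling inequalities. By Bernstein's inequality a polynomial of degree `n`
varies little at scale `δ / n`, so moving each `z_{n,j}` to a nearby retained point costs a small
multiple of the norm, which is absorbed into the left side.

For `p = ∞` nothing more is needed. For finite `p`, the sum of the errors must be controlled by the
`L^p` norm, and few old points may move to the same new one. Both rest on a count: testing the left
M-Z inequality on a squared Dirichlet kernel shows that an arc of radius `1 / n` holds `O(m_n / n)`
points (`card_filter_norm_sub_le`). The Plancherel-Polya inequality `sum_norm_eval_rpow_le`,
obtained from a local Sobolev bound and Bernstein, then controls sampled sums of the derivative, and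
`circleLpPow_le_of_net` combines these facts.

The reverse inequality for the new points needs only their separation. Constants first come out
normalized by `n`; testing with `q = 1` shows that `n` is comparable to the number of new points. -/

open Polynomial Finset

/-! ### Discrete Fourier orthogonality and Riesz interpolation -/

theorem sum_rootOfUnity_pow_eq_ite {N : ℕ} {ζ : ℂ} (hζ : IsPrimitiveRoot ζ N) {a b : ℕ}
    (ha : a < N) (hb : b < N) :
    ∑ k ∈ range N, (ζ ^ a * ζ⁻¹ ^ b) ^ k = if a = b then (N : ℂ) else 0 := by
  have h0 : ζ ≠ 0 := hζ.ne_zero (by omega)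
  split_ifs with h
  · subst h
    simp [h0]
  · have hne : ζ ^ a * ζ⁻¹ ^ b ≠ 1 := by
      intro h1
      rw [inv_pow, mul_inv_eq_one₀ (pow_ne_zero _ h0)] at h1
      exact h (hζ.pow_inj ha hb h1)
    rw [geom_sum_eq hne]
    have : (ζ ^ a * ζ⁻¹ ^ b) ^ N = 1 := by
      rw [mul_pow, ← pow_mul, ← pow_mul, mul_comm a, mul_comm b, pow_mul, pow_mul, inv_pow,
        hζ.pow_eq_one]
      simp
    rw [this, sub_self, zero_div]

/-- For `m ≤ n` each `a < m` has exactly one partner `b`. This is the rising half of the triangular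
Fejér coefficients, and it produces the factor `m` of the derivative. -/
theorem sum_range_sum_range_ite_add_eq {n m : ℕ} (hm : m ≤ n) :
    ∑ a ∈ range n, ∑ b ∈ range n, (if m = a + b + 1 then (1 : ℂ) else 0) = m := by
  have h : ∀ a ∈ range n, ∑ b ∈ range n, (if m = a + b + 1 then (1 : ℂ) else 0)
      = if a < m then 1 else 0 := by
    intro a _
    split_ifs with h
    · rw [Finset.sum_eq_single (m - 1 - a)]
      · rw [if_pos (by omega)]
      · intro b _ hb
        rw [if_neg (by omega)]
      · intro hb
        simp only [mem_range] at hb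
        omega
    · exact Finset.sum_eq_zero fun b _ => if_neg (by omega)
  rw [Finset.sum_congr rfl h, Finset.sum_boole]
  have : (range n).filter (· < m) = range m := by
    ext a; simp only [mem_filter, mem_range]; omega
  rw [this, card_range]

theorem natDegree_X_mul_derivative_le (q : ℂ[X]) : (X * derivative q).natDegree ≤ q.natDegree := by
  rcases Nat.eq_zero_or_pos q.natDegree with h | h
  · rw [derivative_of_natDegree_zero h]
    simp
  · refine natDegree_mul_le.trans ?_
    rw [natDegree_X]
    have := natDegree_derivative_lt h.ne'
    omega

/-- M. Riesz interpolation formula for the angular derivative of a polynomial on the circle. -/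
theorem exists_riesz_interpolation {n : ℕ} (hn : 1 ≤ n) :
    ∃ (c : ℕ → ℂ) (ω : ℕ → Circle), ∑ k ∈ range (2 * n), ‖c k‖ = n ∧
      ∀ q : ℂ[X], q.natDegree ≤ n → ∀ z : ℂ,
        (X * derivative q).eval z = ∑ k ∈ range (2 * n), c k * q.eval (ω k * z) := by
  have hN : 2 * n ≠ 0 := by omega
  set ζ : ℂ := Complex.exp (2 * Real.pi * Complex.I / (2 * n : ℕ))
  have hζ : IsPrimitiveRoot ζ (2 * n) := Complex.isPrimitiveRoot_exp _ hN
  have hnorm : ‖ζ‖ = 1 := hζ.norm'_eq_one hN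
  have h0 : ζ ≠ 0 := hζ.ne_zero hN
  have hconj : (starRingEnd ℂ) ζ⁻¹ = ζ := by
    rw [Complex.inv_eq_conj hnorm, Complex.conj_conj]
  have hnC : (2 * n : ℂ) ≠ 0 := by exact_mod_cast hN
  -- Samples of a Fejér kernel shifted to the frequencies `a + b + 1`, which run from `1` to `2n -
  -- 1`. There is thus no aliasing modulo `2n`, and the modulus is a square, so the norms can be
  -- summed exactly.
  let c : ℕ → ℂ := fun k => (2 * n : ℂ)⁻¹ * (ζ⁻¹ ^ k * (∑ a ∈ range n, (ζ⁻¹ ^ a) ^ k) ^ 2)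
  let ω : ℕ → Circle := fun k => ⟨ζ ^ k, by simp [Submonoid.unitSphere, hnorm]⟩
  refine ⟨c, ω, ?_, ?_⟩
  · have h1 : ∀ k, ((‖c k‖ : ℝ) : ℂ) = (2 * n : ℂ)⁻¹ *
        ∑ a ∈ range n, ∑ b ∈ range n, (ζ ^ a * ζ⁻¹ ^ b) ^ k := by
      intro k
      have h2 : ‖c k‖ = (2 * n : ℝ)⁻¹ * ‖∑ a ∈ range n, (ζ⁻¹ ^ a) ^ k‖ ^ 2 := by
        simp [c, hnorm]
      rw [h2]
      push_cast
      rw [← Complex.conj_mul', map_sum, Finset.sum_mul_sum]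
      simp only [map_pow, hconj, mul_pow]
    have h2 : ((∑ k ∈ range (2 * n), ‖c k‖ : ℝ) : ℂ) = n := by
      push_cast
      rw [Finset.sum_congr rfl fun k _ => h1 k, ← Finset.mul_sum, Finset.sum_comm]
      have h3 : ∀ a ∈ range n, ∑ k ∈ range (2 * n), ∑ b ∈ range n, (ζ ^ a * ζ⁻¹ ^ b) ^ k
          = 2 * n := by
        intro a ha
        rw [mem_range] at ha
        rw [Finset.sum_comm, Finset.sum_congr rfl fun b hb =>
          sum_rootOfUnity_pow_eq_ite hζ (by omega) (by rw [mem_range] at hb; omega)]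
        simp [ha]
      rw [Finset.sum_congr rfl h3]
      simp only [sum_const, card_range, nsmul_eq_mul]
      field_simp
    exact_mod_cast h2
  · intro q hq z
    have key : ∀ m ∈ range (n + 1), ∑ k ∈ range (2 * n), c k * (ζ ^ k) ^ m = m := by
      intro m hm
      rw [mem_range] at hm
      have h1 : ∀ k, c k * (ζ ^ k) ^ m = (2 * n : ℂ)⁻¹ *
          ∑ a ∈ range n, ∑ b ∈ range n, (ζ ^ m * ζ⁻¹ ^ (a + b + 1)) ^ k := by
        intro k
        simp only [c]
        rw [mul_assoc]
        congr 1
        rw [sq, Finset.sum_mul_sum, Finset.mul_sum, Finset.sum_mul]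
        refine Finset.sum_congr rfl fun a _ => ?_
        rw [Finset.mul_sum, Finset.sum_mul]
        refine Finset.sum_congr rfl fun b _ => ?_
        simp only [pow_add, mul_pow, ← pow_mul]
        ring
      rw [Finset.sum_congr rfl fun k _ => h1 k, ← Finset.mul_sum, Finset.sum_comm]
      have h3 : ∀ a ∈ range n, ∑ k ∈ range (2 * n), ∑ b ∈ range n,
          (ζ ^ m * ζ⁻¹ ^ (a + b + 1)) ^ k
          = 2 * n * ∑ b ∈ range n, (if m = a + b + 1 then (1 : ℂ) else 0) := by
        intro a ha
        rw [mem_range] at ha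
        rw [Finset.sum_comm, Finset.sum_congr rfl fun b hb =>
          sum_rootOfUnity_pow_eq_ite hζ (by omega) (by rw [mem_range] at hb; omega),
          Finset.mul_sum]
        simp
      rw [Finset.sum_congr rfl h3, ← Finset.mul_sum,
        sum_range_sum_range_ite_add_eq (by omega), inv_mul_cancel_left₀ hnC]
    rw [eval_eq_sum_range' (Nat.lt_succ_of_le ((natDegree_X_mul_derivative_le q).trans hq))]
    simp_rw [eval_eq_sum_range' (Nat.lt_succ_of_le hq), Finset.mul_sum]
    rw [Finset.sum_comm]
    refine Finset.sum_congr rfl fun m hm => ?_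
    have h4 : (X * derivative q).coeff m = m * q.coeff m := by
      cases m with
      | zero => simp
      | succ m => rw [coeff_X_mul, coeff_derivative]; push_cast; ring
    rw [h4, ← key m hm, Finset.sum_mul, Finset.sum_mul]
    refine Finset.sum_congr rfl fun k _ => ?_
    simp only [ω, mul_pow]
    ring

/-! ### `L^p` norms on the circle and Bernstein's inequality -/

/-- The `p`-th power of the `L^p` norm of a polynomial on the unit circle. -/
noncomputable def circleLpPow (p : ℝ) (q : ℂ[X]) : ℝ :=
  ∫ θ in (0 : ℝ)..(2 * Real.pi), ‖q.eval (Circle.exp θ : ℂ)‖ ^ p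

theorem circleLpPow_nonneg (p : ℝ) (q : ℂ[X]) : 0 ≤ circleLpPow p q :=
  intervalIntegral.integral_nonneg Real.two_pi_pos.le fun _ _ => by positivity

theorem continuous_eval_circleExp (q : ℂ[X]) :
    Continuous fun θ : ℝ => q.eval (Circle.exp θ : ℂ) :=
  q.continuous.comp (continuous_subtype_val.comp Circle.exp.continuous)

theorem continuous_norm_eval_circleExp_rpow {p : ℝ} (hp : 0 ≤ p) (q : ℂ[X]) :
    Continuous fun θ : ℝ => ‖q.eval (Circle.exp θ : ℂ)‖ ^ p :=
  (continuous_eval_circleExp q).norm.rpow_const fun _ => Or.inr hp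

theorem integral_norm_eval_mul_circleExp (p : ℝ) (q : ℂ[X]) (w : Circle) :
    ∫ θ in (0 : ℝ)..(2 * Real.pi), ‖q.eval (w * Circle.exp θ : ℂ)‖ ^ p = circleLpPow p q := by
  obtain ⟨a, rfl⟩ := Circle.exp_surjective w
  have hper : Function.Periodic (fun θ : ℝ => ‖q.eval (Circle.exp θ : ℂ)‖ ^ p) (2 * Real.pi) := by
    intro θ
    simp only [Circle.exp_add_two_pi]
  have h1 : ∀ θ : ℝ, ‖q.eval (Circle.exp a * Circle.exp θ : ℂ)‖ ^ p =
      (fun θ : ℝ => ‖q.eval (Circle.exp θ : ℂ)‖ ^ p) (θ + a) := by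
    intro θ
    simp only
    rw [add_comm, Circle.exp_add, Circle.coe_mul]
  simp_rw [h1]
  rw [intervalIntegral.integral_comp_add_right (fun θ : ℝ => ‖q.eval (Circle.exp θ : ℂ)‖ ^ p) a,
    add_comm (2 * Real.pi) a, zero_add, hper.intervalIntegral_add_eq a 0, zero_add, circleLpPow]

theorem X_mul_derivative_eq_zero {q : ℂ[X]} (h : q.natDegree ≤ 0) : X * derivative q = 0 := by
  rw [derivative_of_natDegree_zero (Nat.le_zero.1 h), mul_zero]

/-- Bernstein's inequality on the unit circle in the uniform norm. -/
theorem norm_X_mul_derivative_eval_le {n : ℕ} {q : ℂ[X]} (hq : q.natDegree ≤ n) {M : ℝ}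
    (hM : ∀ z : Circle, ‖q.eval (z : ℂ)‖ ≤ M) (z : Circle) :
    ‖(X * derivative q).eval (z : ℂ)‖ ≤ n * M := by
  rcases Nat.eq_zero_or_pos n with rfl | hn
  · rw [X_mul_derivative_eq_zero hq]
    simp
  obtain ⟨c, ω, hc, h⟩ := exists_riesz_interpolation hn
  rw [h q hq, ← hc, Finset.sum_mul]
  refine norm_sum_le_of_le _ fun k _ => ?_
  rw [norm_mul, ← Circle.coe_mul]
  exact mul_le_mul_of_nonneg_left (hM _) (norm_nonneg _)

/-- Bernstein's inequality on the unit circle in the `L^p` norm. -/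
theorem circleLpPow_X_mul_derivative_le {p : ℝ} (hp : 1 ≤ p) {n : ℕ} (hn : 1 ≤ n) {q : ℂ[X]}
    (hq : q.natDegree ≤ n) :
    circleLpPow p (X * derivative q) ≤ (n : ℝ) ^ p * circleLpPow p q := by
  obtain ⟨c, ω, hc, h⟩ := exists_riesz_interpolation hn
  have hn0 : (0 : ℝ) < n := by exact_mod_cast hn
  have hp0 : 0 ≤ p := by linarith
  -- The weights `‖c k‖ / n` sum to `1`, so convexity of `x ^ p` applies.
  have hpt : ∀ z : ℂ, ‖(X * derivative q).eval z‖ ^ p ≤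
      (n : ℝ) ^ p * ∑ k ∈ range (2 * n), (‖c k‖ / n) * ‖q.eval (ω k * z)‖ ^ p := by
    intro z
    have h1 : ‖(X * derivative q).eval z‖ ≤
        n * ∑ k ∈ range (2 * n), (‖c k‖ / n) * ‖q.eval (ω k * z)‖ := by
      rw [h q hq, Finset.mul_sum]
      refine norm_sum_le_of_le _ fun k _ => ?_
      rw [norm_mul]
      apply le_of_eq
      field_simp
    refine (Real.rpow_le_rpow (norm_nonneg _) h1 hp0).trans ?_
    rw [Real.mul_rpow hn0.le (Finset.sum_nonneg fun _ _ => by positivity)]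
    refine mul_le_mul_of_nonneg_left ?_ (by positivity)
    refine Real.rpow_arith_mean_le_arith_mean_rpow _ _ _ (fun _ _ => by positivity) ?_
      (fun _ _ => norm_nonneg _) hp
    rw [← Finset.sum_div, hc, div_self hn0.ne']
  have hcont : ∀ k, Continuous fun θ : ℝ =>
      (‖c k‖ / n) * ‖q.eval (ω k * Circle.exp θ : ℂ)‖ ^ p := by
    intro k
    refine continuous_const.mul (Continuous.rpow_const (Continuous.norm ?_) fun _ => Or.inr hp0)
    exact q.continuous.comp
      (continuous_const.mul (continuous_subtype_val.comp Circle.exp.continuous))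
  calc circleLpPow p (X * derivative q)
      ≤ ∫ θ in (0 : ℝ)..(2 * Real.pi), (n : ℝ) ^ p *
          ∑ k ∈ range (2 * n), (‖c k‖ / n) * ‖q.eval (ω k * Circle.exp θ : ℂ)‖ ^ p := by
        refine intervalIntegral.integral_mono_on Real.two_pi_pos.le
          ((continuous_norm_eval_circleExp_rpow hp0 _).intervalIntegrable _ _)
          (Continuous.intervalIntegrable ?_ _ _) fun θ _ => hpt _
        exact continuous_const.mul (continuous_finsetSum _ fun k _ => hcont k)
    _ = (n : ℝ) ^ p * circleLpPow p q := by
        rw [intervalIntegral.integral_const_mul, intervalIntegral.integral_finsetSum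
          fun k _ => (hcont k).intervalIntegrable _ _]
        simp_rw [intervalIntegral.integral_const_mul, integral_norm_eval_mul_circleExp]
        rw [← Finset.sum_mul, ← Finset.sum_div, hc, div_self hn0.ne', one_mul]

/-! ### Local Sobolev bound on short arcs -/

/-- Jensen's inequality for interval integrals and the function `x ^ p`. -/
theorem rpow_integral_le {p : ℝ} (hp : 1 ≤ p) {a b : ℝ} (hab : a < b) {g : ℝ → ℝ}
    (hg : Continuous g) (h0 : ∀ x, 0 ≤ g x) :
    (∫ x in a..b, g x) ^ p ≤ (b - a) ^ (p - 1) * ∫ x in a..b, g x ^ p := by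
  have hba : 0 < b - a := sub_pos.2 hab
  have hgp : Continuous fun x => g x ^ p := hg.rpow_const fun _ => Or.inr (by linarith)
  have h := (convexOn_rpow hp).map_set_average_le (μ := MeasureTheory.volume) (t := Set.Ioc a b)
    (f := g)
    (continuousOn_id.rpow_const fun _ _ => Or.inr (by linarith)) isClosed_Ici
    (by simp [hab]) (by simp)
    (Filter.Eventually.of_forall fun x => h0 x) (hg.integrableOn_Ioc) (hgp.integrableOn_Ioc)
  rw [MeasureTheory.setAverage_eq, MeasureTheory.setAverage_eq] at h
  simp only [MeasureTheory.Measure.real, Real.volume_Ioc, smul_eq_mul,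
    ENNReal.toReal_ofReal hba.le] at h
  rw [intervalIntegral.integral_of_le hab.le, intervalIntegral.integral_of_le hab.le]
  have hI : 0 ≤ ∫ x in Set.Ioc a b, g x := MeasureTheory.setIntegral_nonneg measurableSet_Ioc
    fun x _ => h0 x
  rw [Real.mul_rpow (by positivity) hI, Real.inv_rpow hba.le] at h
  rw [Real.rpow_sub_one hba.ne']
  have hpos : 0 < (b - a) ^ p := by positivity
  rw [inv_mul_le_iff₀ hpos] at h
  calc _ ≤ _ := h
    _ = _ := by ring

theorem add_rpow_le_two_rpow_mul {p : ℝ} (hp : 1 ≤ p) {x y : ℝ} (hx : 0 ≤ x) (hy : 0 ≤ y) :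
    (x + y) ^ p ≤ 2 ^ (p - 1) * (x ^ p + y ^ p) := by
  have := NNReal.rpow_add_le_mul_rpow_add_rpow ⟨x, hx⟩ ⟨y, hy⟩ hp
  exact_mod_cast this

theorem hasDerivAt_eval_circleExp (q : ℂ[X]) (t : ℝ) :
    HasDerivAt (fun θ : ℝ => q.eval (Circle.exp θ : ℂ))
      (Complex.I * (X * derivative q).eval (Circle.exp t : ℂ)) t := by
  have h1 : HasDerivAt (fun θ : ℝ => Complex.exp (θ * Complex.I))
      (Complex.exp (t * Complex.I) * (1 * Complex.I)) t :=
    ((Complex.ofRealCLM.hasDerivAt (x := t)).mul_const Complex.I).cexp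
  have h2 := (q.hasDerivAt (Complex.exp (t * Complex.I))).comp t h1
  have h3 : (derivative q).eval (Complex.exp (t * Complex.I)) *
      (Complex.exp (t * Complex.I) * (1 * Complex.I)) =
      Complex.I * (X * derivative q).eval (Circle.exp t : ℂ) := by
    rw [eval_mul, eval_X, Circle.coe_exp]
    ring
  rw [← h3]
  exact h2

/-- A local Sobolev inequality for `L^p` on a short arc. -/
theorem norm_eval_rpow_le_integral {p : ℝ} (hp : 1 ≤ p) (q : ℂ[X]) {a b t : ℝ} (hab : a < b)
    (ht : t ∈ Set.Icc a b) :
    ‖q.eval (Circle.exp t : ℂ)‖ ^ p ≤ 2 ^ (p - 1) *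
      ((b - a)⁻¹ * (∫ θ in a..b, ‖q.eval (Circle.exp θ : ℂ)‖ ^ p) +
        (b - a) ^ (p - 1) * ∫ θ in a..b, ‖(X * derivative q).eval (Circle.exp θ : ℂ)‖ ^ p) := by
  have hp0 : 0 ≤ p := by linarith
  have hba : 0 < b - a := sub_pos.2 hab
  set f : ℝ → ℂ := fun θ => q.eval (Circle.exp θ : ℂ)
  set g : ℝ → ℝ := fun θ => ‖(X * derivative q).eval (Circle.exp θ : ℂ)‖
  have hg : Continuous g := (continuous_eval_circleExp _).norm
  have hf' : Continuous fun θ : ℝ => Complex.I * (X * derivative q).eval (Circle.exp θ : ℂ) :=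
    continuous_const.mul (continuous_eval_circleExp _)
  set J := ∫ θ in a..b, g θ with hJ
  have hJ0 : 0 ≤ J := intervalIntegral.integral_nonneg hab.le fun _ _ => norm_nonneg _
  -- The oscillation over the arc is at most `J`. Averaging over the free point `s` later replaces
  -- the value at `s` by an integral.
  have h1 : ∀ s ∈ Set.Icc a b, ‖f t‖ ^ p ≤ 2 ^ (p - 1) * (‖f s‖ ^ p + J ^ p) := by
    intro s hs
    have h2 := intervalIntegral.integral_eq_sub_of_hasDerivAt (a := s) (b := t)
      (fun x _ => hasDerivAt_eval_circleExp q x) (hf'.intervalIntegrable _ _)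
    have h3 : ‖f t - f s‖ ≤ J := by
      rw [← h2]
      refine (intervalIntegral.norm_integral_le_abs_integral_norm).trans ?_
      simp only [norm_mul, Complex.norm_I, one_mul]
      rw [← abs_of_nonneg hJ0]
      exact intervalIntegral.abs_integral_mono_interval
        (by
          rw [Set.uIoc_of_le hab.le]
          exact fun x hx => ⟨(le_min hs.1 ht.1).trans_lt hx.1, hx.2.trans (max_le hs.2 ht.2)⟩)
        (Filter.Eventually.of_forall fun _ => norm_nonneg _) (hg.intervalIntegrable _ _)
    have h4 : ‖f t‖ ≤ ‖f s‖ + J := by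
      have := norm_sub_norm_le (f t) (f s)
      linarith
    exact (Real.rpow_le_rpow (norm_nonneg _) h4 hp0).trans
      (add_rpow_le_two_rpow_mul hp (norm_nonneg _) hJ0)
  have hfc := continuous_norm_eval_circleExp_rpow hp0 q
  have h5 : ∫ _ in a..b, ‖f t‖ ^ p ≤ ∫ s in a..b, 2 ^ (p - 1) * (‖f s‖ ^ p + J ^ p) :=
    intervalIntegral.integral_mono_on hab.le (continuous_const.intervalIntegrable _ _)
      ((continuous_const.mul (hfc.add continuous_const)).intervalIntegrable a b) h1
  rw [intervalIntegral.integral_const, intervalIntegral.integral_const_mul,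
    intervalIntegral.integral_add (hfc.intervalIntegrable _ _)
      (continuous_const.intervalIntegrable _ _),
    intervalIntegral.integral_const, smul_eq_mul, smul_eq_mul] at h5
  have h6 : J ^ p ≤ (b - a) ^ (p - 1) * ∫ x in a..b, g x ^ p :=
    rpow_integral_le hp hab hg fun _ => norm_nonneg _
  calc ‖f t‖ ^ p = (b - a)⁻¹ * ((b - a) * ‖f t‖ ^ p) := by field_simp
    _ ≤ (b - a)⁻¹ * (2 ^ (p - 1) * ((∫ θ in a..b, ‖f θ‖ ^ p) + (b - a) * J ^ p)) := by
        gcongr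
    _ = 2 ^ (p - 1) * ((b - a)⁻¹ * (∫ θ in a..b, ‖f θ‖ ^ p) + J ^ p) := by field_simp
    _ ≤ _ := by gcongr

/-! ### Plancherel-Polya inequality -/

theorem Circle.norm_exp_sub_exp_le (a b : ℝ) :
    ‖(Circle.exp a : ℂ) - Circle.exp b‖ ≤ |a - b| := by
  have h : (Circle.exp a : ℂ) - Circle.exp b =
      Circle.exp b * (Complex.exp (Complex.I * (a - b : ℝ)) - 1) := by
    have : Circle.exp a = Circle.exp b * Circle.exp (a - b) := by
      rw [← Circle.exp_add]
      congr 1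
      ring
    rw [this, Circle.coe_mul, Circle.coe_exp (a - b), mul_comm Complex.I]
    ring
  rw [h, norm_mul, Circle.norm_coe, one_mul]
  exact Real.norm_exp_I_mul_ofReal_sub_one_le

theorem Circle.exists_exp_eq_mem_Ico (z : Circle) :
    ∃ θ ∈ Set.Ico 0 (2 * Real.pi), Circle.exp θ = z := by
  have h1 := Complex.neg_pi_lt_arg (z : ℂ)
  have h2 := Complex.arg_le_pi (z : ℂ)
  have h3 := Real.pi_pos
  rcases lt_or_ge (Complex.arg z) 0 with h | h
  · exact ⟨Complex.arg z + 2 * Real.pi, ⟨by linarith, by linarith⟩, by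
      rw [Circle.exp_add_two_pi, Circle.exp_arg]⟩
  · exact ⟨Complex.arg z, ⟨h, by linarith⟩, Circle.exp_arg z⟩

/-- A Plancherel-Polya type inequality: if every arc of radius `ρ / n` contains at most `B` of the
points `y j`, then the sampling operator at these points is bounded on polynomials of degree
at most `n`. -/
theorem sum_norm_eval_rpow_le {p : ℝ} (hp : 1 ≤ p) {ι : Type*} [Fintype ι] (y : ι → Circle)
    {n : ℕ} (hn : 1 ≤ n) {ρ B : ℝ} (hρ0 : 0 < ρ) (hρ1 : ρ ≤ 1)
    (hy : ∀ w : Circle, ((univ.filter fun j => ‖(y j : ℂ) - w‖ ≤ ρ / n).card : ℝ) ≤ B)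
    {q : ℂ[X]} (hq : q.natDegree ≤ n) :
    ∑ j, ‖q.eval (y j : ℂ)‖ ^ p ≤ 2 ^ p * ⌈7 / ρ⌉₊ * B * n * circleLpPow p q := by
  have hp0 : 0 ≤ p := by linarith
  have hB : 0 ≤ B := (Nat.cast_nonneg _).trans (hy 1)
  have hn1 : (1 : ℝ) ≤ n := by exact_mod_cast hn
  have hn0 : (0 : ℝ) < n := by linarith
  -- Since `7 > 2π`, cutting the circle into `n * r` equal cells makes their length `h` at most `ρ /
  -- n`.
  set r := ⌈7 / ρ⌉₊
  have hr : 7 / ρ ≤ r := Nat.le_ceil _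
  have hr7 : (7 : ℝ) ≤ r := le_trans (by rw [le_div_iff₀ hρ0]; linarith) hr
  have hr0 : (0 : ℝ) < r := by linarith
  set h : ℝ := 2 * Real.pi / (n * r) with hh
  have h0 : 0 < h := by positivity
  have hpi := Real.pi_lt_d2
  have hpi3 := Real.pi_gt_three
  have hhρ : h ≤ ρ / n := by
    rw [hh, div_le_div_iff₀ (by positivity) hn0]
    have : 7 ≤ r * ρ := (div_le_iff₀ hρ0).1 hr
    nlinarith
  have hhn : h * n ≤ 1 := by
    rw [le_div_iff₀ hn0] at hhρ
    linarith
  choose θ hθ hθy using fun j => Circle.exists_exp_eq_mem_Ico (y j)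
  let κ : ι → ℕ := fun j => ⌊θ j / h⌋₊
  have hκ : ∀ j, κ j ∈ range (n * r) := by
    intro j
    rw [mem_range, Nat.floor_lt (div_nonneg (hθ j).1 h0.le), div_lt_iff₀ h0]
    push_cast
    have : (n * r : ℝ) * h = 2 * Real.pi := by
      rw [hh]; field_simp
    rw [this]
    exact (hθ j).2
  have hκθ : ∀ j, θ j ∈ Set.Icc (κ j * h) ((κ j + 1 : ℕ) * h) := by
    intro j
    constructor
    · exact (le_div_iff₀ h0).1 (Nat.floor_le (div_nonneg (hθ j).1 h0.le))
    · have := (Nat.lt_floor_add_one (θ j / h)).le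
      rw [div_le_iff₀ h0] at this
      exact_mod_cast this
  let I : ℂ[X] → ℕ → ℝ := fun f k =>
    ∫ t in ((k : ℝ) * h)..((k + 1 : ℕ) * h), ‖f.eval (Circle.exp t : ℂ)‖ ^ p
  have hI : ∀ f k, 0 ≤ I f k := fun f k => intervalIntegral.integral_nonneg
    (mul_le_mul_of_nonneg_right (by simp) h0.le) fun _ _ => by positivity
  have hIsum : ∀ f, ∑ k ∈ range (n * r), I f k = circleLpPow p f := by
    intro f
    have := intervalIntegral.sum_integral_adjacent_intervals (n := n * r)
      (a := fun k : ℕ => (k : ℝ) * h) (μ := MeasureTheory.volume)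
      (fun k _ => (continuous_norm_eval_circleExp_rpow hp0 f).intervalIntegrable _ _)
    rw [this, circleLpPow]
    congr 1
    · simp
    · rw [hh]; push_cast; field_simp
  let S : ℕ → ℝ := fun k => 2 ^ (p - 1) * (h⁻¹ * I q k + h ^ (p - 1) * I (X * derivative q) k)
  have hS : ∀ k, 0 ≤ S k := fun k => by
    have := hI q k
    have := hI (X * derivative q) k
    positivity
  have hpt : ∀ j, ‖q.eval (y j : ℂ)‖ ^ p ≤ S (κ j) := by
    intro j
    have h1 := norm_eval_rpow_le_integral hp q
      (mul_lt_mul_of_pos_right (by simp : (κ j : ℝ) < (κ j + 1 : ℕ)) h0) (hκθ j)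
    have h2 : ((κ j + 1 : ℕ) : ℝ) * h - κ j * h = h := by push_cast; ring
    rwa [hθy, h2] at h1
  -- A cell lies within `h ≤ ρ / n` of its left endpoint, so the counting hypothesis applies there.
  have hcard : ∀ k, ((univ.filter fun j => κ j = k).card : ℝ) ≤ B := by
    intro k
    refine le_trans ?_ (hy (Circle.exp (k * h)))
    refine Nat.cast_le.2 (card_le_card fun j hj => ?_)
    simp only [mem_filter, mem_univ, true_and] at hj ⊢
    rw [← hθy]
    refine (Circle.norm_exp_sub_exp_le _ _).trans (le_trans ?_ hhρ)
    have h1 := hκθ j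
    rw [hj] at h1
    have h2 := h1.2
    push_cast at h2
    rw [abs_of_nonneg (sub_nonneg.2 h1.1)]
    linarith
  have hBern := circleLpPow_X_mul_derivative_le hp hn hq
  have hL := circleLpPow_nonneg p q
  -- With `h` of order `1 / n`, both terms of the Sobolev bound are of order `n`, the second after
  -- Bernstein.
  have e1 : h⁻¹ ≤ n * r := by
    rw [hh, inv_div]
    refine div_le_self (by positivity) (by linarith)
  have e2 : h ^ (p - 1) * (n : ℝ) ^ p ≤ n * r := by
    have : h ^ (p - 1) * (n : ℝ) ^ p = (h * n) ^ (p - 1) * n := by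
      rw [Real.mul_rpow h0.le hn0.le, mul_assoc, ← Real.rpow_add_one hn0.ne', sub_add_cancel]
    rw [this]
    have : (h * n) ^ (p - 1) ≤ 1 := Real.rpow_le_one (by positivity) hhn (by linarith)
    nlinarith
  calc ∑ j, ‖q.eval (y j : ℂ)‖ ^ p ≤ ∑ j, S (κ j) := Finset.sum_le_sum fun j _ => hpt j
    _ = ∑ k ∈ range (n * r), ∑ j ∈ univ.filter (fun j => κ j = k), S (κ j) :=
        (Finset.sum_fiberwise_of_maps_to (fun j _ => hκ j) _).symm
    _ ≤ ∑ k ∈ range (n * r), B * S k := by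
        refine Finset.sum_le_sum fun k _ => ?_
        rw [Finset.sum_congr rfl (g := fun _ => S k) fun j hj => by
          rw [(mem_filter.1 hj).2], sum_const, nsmul_eq_mul]
        exact mul_le_mul_of_nonneg_right (hcard k) (hS k)
    _ = B * (2 ^ (p - 1) * (h⁻¹ * circleLpPow p q +
          h ^ (p - 1) * circleLpPow p (X * derivative q))) := by
        rw [← Finset.mul_sum, ← Finset.mul_sum, Finset.sum_add_distrib, ← Finset.mul_sum,
          ← Finset.mul_sum, hIsum, hIsum]
    _ ≤ B * (2 ^ (p - 1) * (n * r * circleLpPow p q + n * r * circleLpPow p q)) := by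
        have h3 : h ^ (p - 1) * circleLpPow p (X * derivative q) ≤ n * r * circleLpPow p q :=
          calc _ ≤ h ^ (p - 1) * ((n : ℝ) ^ p * circleLpPow p q) := by gcongr
            _ = h ^ (p - 1) * (n : ℝ) ^ p * circleLpPow p q := by ring
            _ ≤ _ := by gcongr
        gcongr
    _ = 2 ^ p * r * B * n * circleLpPow p q := by
        rw [Real.rpow_sub_one two_ne_zero]
        ring

/-! ### Mean value inequality along arcs -/

/-- The mean value inequality along an arc of the unit circle. -/
theorem exists_norm_eval_sub_le (q : ℂ[X]) (z x : Circle) :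
    ∃ y : Circle, ‖(y : ℂ) - z‖ ≤ 2 * ‖(z : ℂ) - x‖ ∧
      ‖q.eval (z : ℂ) - q.eval (x : ℂ)‖ ≤
        2 * ‖(z : ℂ) - x‖ * ‖(X * derivative q).eval (y : ℂ)‖ := by
  obtain ⟨b, rfl⟩ := Circle.exp_surjective x
  set φ := Complex.arg (z / Circle.exp b : Circle) with hφ
  have hz : Circle.exp (b + φ) = z := by
    rw [Circle.exp_add, hφ, Circle.exp_arg, mul_div_cancel]
  -- The principal argument selects the shorter arc, whose length is at most `π / 2 ≤ 2` times the
  -- chord.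
  have hφle : |φ| ≤ 2 * ‖(z : ℂ) - Circle.exp b‖ := by
    have h1 := Complex.angle_le_mul_norm_sub (Circle.norm_coe z)
      (Circle.norm_coe (Circle.exp b))
    rw [Complex.angle_eq_abs_arg (Circle.coe_ne_zero _) (Circle.coe_ne_zero _),
      ← Circle.coe_div, ← hφ] at h1
    refine h1.trans (mul_le_mul_of_nonneg_right ?_ (norm_nonneg _))
    linarith [Real.pi_lt_four]
  obtain ⟨t, ht, hmax⟩ := isCompact_uIcc.exists_isMaxOn (Set.nonempty_uIcc (a := b) (b := b + φ))
    (continuous_eval_circleExp (X * derivative q)).norm.continuousOn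
  refine ⟨Circle.exp t, ?_, ?_⟩
  · nth_rewrite 1 [← hz]
    refine (Circle.norm_exp_sub_exp_le _ _).trans (le_trans ?_ hφle)
    have := Set.abs_sub_right_of_mem_uIcc ht
    rw [add_sub_cancel_left] at this
    rwa [abs_sub_comm]
  · have h2 := (convex_uIcc b (b + φ)).norm_image_sub_le_of_norm_hasDerivWithin_le
      (f := fun θ : ℝ => q.eval (Circle.exp θ : ℂ))
      (C := ‖(X * derivative q).eval (Circle.exp t : ℂ)‖)
      (fun s _ => (hasDerivAt_eval_circleExp q s).hasDerivWithinAt)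
      (fun s hs => by
        rw [norm_mul, Complex.norm_I, one_mul]
        exact hmax hs) Set.left_mem_uIcc Set.right_mem_uIcc
    rw [hz, add_sub_cancel_left, Real.norm_eq_abs] at h2
    refine h2.trans ?_
    rw [mul_comm]
    exact mul_le_mul_of_nonneg_right hφle (norm_nonneg _)

/-! ### Dirichlet kernels and the density of sampling points -/

theorem norm_pow_sub_one_le {u : ℂ} (hu : ‖u‖ = 1) (k : ℕ) : ‖u ^ k - 1‖ ≤ k * ‖u - 1‖ := by
  rw [← mul_geom_sum, norm_mul, mul_comm]
  refine mul_le_mul_of_nonneg_right ?_ (norm_nonneg _)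
  exact (norm_sum_le _ _).trans (by simp [hu])

/-- The holomorphic Dirichlet kernel with `N` terms centred at `w`. -/
noncomputable def dirichletPolynomial (N : ℕ) (w : Circle) : ℂ[X] :=
  ∑ k ∈ range N, monomial k (((w⁻¹ : Circle) : ℂ) ^ k)

theorem coeff_dirichletPolynomial (N : ℕ) (w : Circle) (k : ℕ) :
    (dirichletPolynomial N w).coeff k = if k < N then ((w⁻¹ : Circle) : ℂ) ^ k else 0 := by
  simp [dirichletPolynomial, coeff_monomial]

theorem eval_dirichletPolynomial (N : ℕ) (w : Circle) (z : ℂ) :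
    (dirichletPolynomial N w).eval z = ∑ k ∈ range N, (((w⁻¹ : Circle) : ℂ) * z) ^ k := by
  simp [dirichletPolynomial, eval_finsetSum, mul_pow]

theorem norm_eval_dirichletPolynomial_le (N : ℕ) (w z : Circle) :
    ‖(dirichletPolynomial N w).eval (z : ℂ)‖ ≤ N := by
  rw [eval_dirichletPolynomial]
  exact (norm_sum_le _ _).trans (by simp [Circle.norm_coe])

theorem natDegree_dirichletPolynomial_le (N : ℕ) (w : Circle) :
    (dirichletPolynomial N w).natDegree ≤ N - 1 := by
  rw [natDegree_le_iff_coeff_eq_zero]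
  intro k hk
  rw [coeff_dirichletPolynomial, if_neg (by omega)]

theorem integral_norm_eval_dirichletPolynomial_sq (N : ℕ) (w : Circle) :
    ∫ θ in (0 : ℝ)..(2 * Real.pi), ‖(dirichletPolynomial N w).eval (Circle.exp θ : ℂ)‖ ^ 2 =
      2 * Real.pi * N := by
  have h := (dirichletPolynomial N w).sum_sq_norm_coeff_eq_circleAverage
  have hs : (dirichletPolynomial N w).support = range N := by
    ext k
    simp [coeff_dirichletPolynomial]
  rw [hs, Finset.sum_congr rfl (g := fun _ => (1 : ℝ)) fun k hk => by
    rw [coeff_dirichletPolynomial, if_pos (mem_range.1 hk)]; simp [Circle.norm_coe]] at h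
  rw [Real.circleAverage_def] at h
  simp only [sum_const, card_range, nsmul_eq_mul, mul_one, smul_eq_mul, circleMap,
    Complex.ofReal_one, one_mul, zero_add] at h
  simp only [Circle.coe_exp]
  rw [h, mul_inv_cancel_left₀ Real.two_pi_pos.ne']

/-- The squared Dirichlet kernel, which is of size about `N ^ 2` near `w`, has small `L^p` norm. -/
theorem circleLpPow_dirichletPolynomial_sq_le {p : ℝ} (hp : 1 ≤ p) (N : ℕ) (w : Circle) :
    circleLpPow p (dirichletPolynomial N w ^ 2) ≤
      2 * Real.pi * N * ((N : ℝ) ^ 2) ^ (p - 1) := by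
  set P := dirichletPolynomial N w
  have hc : Continuous fun θ : ℝ => ‖P.eval (Circle.exp θ : ℂ)‖ ^ 2 :=
    (continuous_eval_circleExp P).norm.pow 2
  calc circleLpPow p (P ^ 2)
      ≤ ∫ θ in (0 : ℝ)..(2 * Real.pi),
          ((N : ℝ) ^ 2) ^ (p - 1) * ‖P.eval (Circle.exp θ : ℂ)‖ ^ 2 := by
        refine intervalIntegral.integral_mono_on Real.two_pi_pos.le
          ((continuous_norm_eval_circleExp_rpow (by linarith) _).intervalIntegrable _ _)
          ((continuous_const.mul hc).intervalIntegrable _ _) fun θ _ => ?_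
        rw [eval_pow, norm_pow]
        set v := ‖P.eval (Circle.exp θ : ℂ)‖
        have hv : 0 ≤ v := norm_nonneg _
        have hvN : v ≤ N := norm_eval_dirichletPolynomial_le N w _
        rcases hv.eq_or_lt with h | h
        · rw [← h]
          simp [Real.zero_rpow (by linarith : p ≠ 0)]
        -- All but one of the `p` factors `v ^ 2` are bounded by `N ^ 2`; the last is left for
        -- Parseval.
        · have : (v ^ 2) ^ p = (v ^ 2) ^ (p - 1) * v ^ 2 := by
            rw [← Real.rpow_add_one (by positivity), sub_add_cancel]
          rw [this]
          gcongr
    _ = _ := by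
        rw [intervalIntegral.integral_const_mul, integral_norm_eval_dirichletPolynomial_sq]
        ring

/-- The frequencies are at most `n / 2`, so at distance `1 / n` from the centre every term is still
within `1 / 2` of `1`. The same choice keeps the degree of the squared kernel at most `n`. -/
theorem le_norm_eval_dirichletPolynomial {n : ℕ} (hn : 1 ≤ n) {w z : Circle}
    (h : ‖(z : ℂ) - w‖ ≤ 1 / n) :
    ((n / 2 + 1 : ℕ) : ℝ) / 2 ≤ ‖(dirichletPolynomial (n / 2 + 1) w).eval (z : ℂ)‖ := by
  set N := n / 2 + 1 with hNd
  have hn0 : (0 : ℝ) < n := by exact_mod_cast hn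
  rw [eval_dirichletPolynomial, ← Circle.coe_mul]
  set u : Circle := w⁻¹ * z with hu
  have hu1 : ‖(u : ℂ) - 1‖ ≤ 1 / n := by
    have : (u : ℂ) - 1 = (w⁻¹ : Circle) * ((z : ℂ) - w) := by
      rw [mul_sub, hu, Circle.coe_mul, ← Circle.coe_mul w⁻¹ w, inv_mul_cancel, Circle.coe_one]
    rwa [this, norm_mul, Circle.norm_coe, one_mul]
  have h1 : ‖∑ k ∈ range N, ((u : ℂ) ^ k - 1)‖ ≤ ∑ k ∈ range N, (1 / 2 : ℝ) := by
    refine norm_sum_le_of_le _ fun k hk => ?_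
    refine (norm_pow_sub_one_le (Circle.norm_coe u) k).trans ?_
    have hk2 : (k : ℝ) ≤ n / 2 := by
      rw [mem_range] at hk
      have : 2 * k ≤ n := by omega
      have : (2 * k : ℝ) ≤ n := by exact_mod_cast this
      linarith
    calc (k : ℝ) * ‖(u : ℂ) - 1‖ ≤ n / 2 * (1 / n) := by gcongr
      _ = 1 / 2 := by field_simp
  rw [Finset.sum_sub_distrib] at h1
  simp only [sum_const, card_range, nsmul_eq_mul, mul_one] at h1
  have h2 := norm_sub_norm_le (N : ℂ) (∑ k ∈ range N, (u : ℂ) ^ k)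
  rw [Complex.norm_natCast, norm_sub_rev] at h2
  linarith

/-- If sampling at the points `y j` is bounded by `A` times the `L^p` norm, then each arc of radius
`1 / n` contains at most a constant times `A / n` of them. -/
theorem card_filter_norm_sub_le {p : ℝ} (hp : 1 ≤ p) {ι : Type*} [Fintype ι] (y : ι → Circle)
    {n : ℕ} (hn : 1 ≤ n) {A : ℝ}
    (h : ∀ q : ℂ[X], q.natDegree ≤ n → ∑ j, ‖q.eval (y j : ℂ)‖ ^ p ≤ A * circleLpPow p q)
    (hA : 0 ≤ A) (w : Circle) :
    ((univ.filter fun j => ‖(y j : ℂ) - w‖ ≤ 1 / n).card : ℝ) ≤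
      16 * 4 ^ p * A / n := by
  set N := n / 2 + 1 with hNd
  have hn0 : (0 : ℝ) < n := by exact_mod_cast hn
  have hN0 : (0 : ℝ) < N := by positivity
  have hnN : (n : ℝ) ≤ 2 * N := by
    have : n ≤ 2 * N := by omega
    exact_mod_cast this
  set P := dirichletPolynomial N w
  have hdeg : (P ^ 2).natDegree ≤ n := by
    refine natDegree_pow_le.trans ?_
    have : P.natDegree ≤ N - 1 := natDegree_dirichletPolynomial_le N w
    omega
  set T := univ.filter fun j => ‖(y j : ℂ) - w‖ ≤ 1 / n
  have h1 : T.card * ((N : ℝ) ^ 2 / 4) ^ p ≤ A * (2 * Real.pi * N * ((N : ℝ) ^ 2) ^ (p - 1)) :=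
    calc T.card * ((N : ℝ) ^ 2 / 4) ^ p = ∑ j ∈ T, ((N : ℝ) ^ 2 / 4) ^ p := by simp
      _ ≤ ∑ j ∈ T, ‖(P ^ 2).eval (y j : ℂ)‖ ^ p := by
          refine Finset.sum_le_sum fun j hj => ?_
          have h2 := le_norm_eval_dirichletPolynomial hn (mem_filter.1 hj).2
          refine Real.rpow_le_rpow (by positivity) ?_ (by linarith)
          rw [eval_pow, norm_pow]
          calc (N : ℝ) ^ 2 / 4 = (N / 2) ^ 2 := by ring
            _ ≤ _ := by gcongr
      _ ≤ ∑ j, ‖(P ^ 2).eval (y j : ℂ)‖ ^ p :=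
          Finset.sum_le_sum_of_subset_of_nonneg (subset_univ _) fun _ _ _ => by positivity
      _ ≤ A * circleLpPow p (P ^ 2) := h _ hdeg
      _ ≤ _ := mul_le_mul_of_nonneg_left
          (circleLpPow_dirichletPolynomial_sq_le hp N w) hA
  have hN2 : ((N : ℝ) ^ 2) ^ p = ((N : ℝ) ^ 2) ^ (p - 1) * (N : ℝ) ^ 2 := by
    rw [← Real.rpow_add_one (by positivity), sub_add_cancel]
  rw [Real.div_rpow (by positivity) (by norm_num), hN2] at h1
  set E := ((N : ℝ) ^ 2) ^ (p - 1)
  have hE : 0 < E := by positivity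
  have h4 : (0 : ℝ) < 4 ^ p := by positivity
  have h5 : T.card * (N : ℝ) ≤ A * (2 * Real.pi) * 4 ^ p := by
    have : (T.card * (N : ℝ)) * (E * N / 4 ^ p) ≤ (A * (2 * Real.pi) * 4 ^ p) * (E * N / 4 ^ p) :=
      calc _ = T.card * (E * (N : ℝ) ^ 2 / 4 ^ p) := by ring
        _ ≤ _ := h1
        _ = _ := by field_simp
    exact le_of_mul_le_mul_right this (by positivity)
  rw [le_div_iff₀ hn0]
  have hpi := Real.pi_lt_four
  calc (T.card : ℝ) * n ≤ T.card * (2 * N) := by gcongr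
    _ = 2 * (T.card * N) := by ring
    _ ≤ 2 * (A * (2 * 4) * 4 ^ p) := by
        refine mul_le_mul_of_nonneg_left (h5.trans ?_) (by norm_num)
        gcongr
    _ = _ := by ring

/-! ### Maximal separated subfamilies -/

/-- Every finite sequence of points contains a maximal `η`-separated subsequence. -/
theorem exists_separated_net {m : ℕ} (z : Fin (m + 1) → Circle) {η : ℝ} (hη : 0 ≤ η) :
    ∃ (m' : ℕ) (σ : Fin (m' + 1) → Fin (m + 1)), Function.Injective σ ∧
      (∀ j k, j ≠ k → η ≤ ‖(z (σ j) : ℂ) - z (σ k)‖) ∧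
      ∀ j, ∃ i, ‖(z j : ℂ) - z (σ i)‖ ≤ η := by
  classical
  let F : Finset (Finset (Fin (m + 1))) :=
    univ.filter fun S => ∀ j ∈ S, ∀ k ∈ S, j ≠ k → η ≤ ‖(z j : ℂ) - z k‖
  obtain ⟨S, hS⟩ := F.exists_maximal ⟨∅, by simp [F]⟩
  have hsep := (mem_filter.1 hS.prop).2
  have hnet : ∀ j, ∃ i ∈ S, ‖(z j : ℂ) - z i‖ ≤ η := by
    intro j
    by_contra! hcon
    have hj : j ∉ S := fun hj => by
      have := hcon j hj
      rw [sub_self, norm_zero] at this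
      linarith
    have hmem : insert j S ∈ F := by
      refine mem_filter.2 ⟨mem_univ _, fun a ha b hb hab => ?_⟩
      rcases mem_insert.1 ha with rfl | haS <;> rcases mem_insert.1 hb with rfl | hbS
      · exact absurd rfl hab
      · exact (hcon b hbS).le
      · rw [norm_sub_rev]
        exact (hcon a haS).le
      · exact hsep a haS b hbS hab
    exact hj (hS.le_of_ge hmem (subset_insert j S) (mem_insert_self j S))
  -- A generation with last index `m'` has `m' + 1` members; `S` is nonempty because some member is
  -- close to index `0`.
  have hcard : S.card = S.card - 1 + 1 := by
    obtain ⟨i, hi, -⟩ := hnet 0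
    have := card_pos.2 ⟨i, hi⟩
    omega
  refine ⟨S.card - 1, S.orderEmbOfFin hcard, (S.orderEmbOfFin hcard).injective,
    fun j k hjk => ?_, fun j => ?_⟩
  · exact hsep _ (S.orderEmbOfFin_mem hcard j) _ (S.orderEmbOfFin_mem hcard k)
      fun h => hjk ((S.orderEmbOfFin hcard).injective h)
  · obtain ⟨i, hi, hji⟩ := hnet j
    have : i ∈ Set.range (S.orderEmbOfFin hcard) := by
      rw [range_orderEmbOfFin]
      exact hi
    obtain ⟨a, rfl⟩ := this
    exact ⟨a, hji⟩

/-- For `n = 0` the radius `δ / n` is `0`, so every point of generation `0` still occurs in `W`. -/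
theorem TriangularFamily.exists_separated_subfamily (Z : TriangularFamily) {δ : ℝ} (hδ : 0 ≤ δ) :
    ∃ W : TriangularFamily, W.IsSubfamily Z ∧
      (∀ n j k, j ≠ k → δ / n ≤ ‖(W.point n j : ℂ) - W.point n k‖) ∧
      ∀ n j, ∃ i, ‖(Z.point n j : ℂ) - W.point n i‖ ≤ δ / n := by
  choose m' σ hσ hsep hnet using fun n : ℕ =>
    exists_separated_net (Z.point n) (div_nonneg hδ n.cast_nonneg : 0 ≤ δ / n)
  exact ⟨⟨m', fun n j => Z.point n (σ n j)⟩, fun n => ⟨σ n, hσ n, fun _ => rfl⟩, hsep, hnet⟩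

/-! ### Sampling inequalities on a separated net -/

theorem circleLpPow_one (p : ℝ) : circleLpPow p 1 = 2 * Real.pi := by
  simp [circleLpPow]

/-- The upper sampling inequality passes to a sufficiently dense net of the sampling points. -/
theorem circleLpPow_le_of_net {p : ℝ} (hp : 1 ≤ p) {n m : ℕ} (hn : 1 ≤ n) (hm : 1 ≤ m)
    {ι κ : Type*} [Fintype ι] [Fintype κ] (z : ι → Circle) (x : κ → Circle) {C c δ : ℝ}
    (hC : 0 < C) (hc : 0 < c)
    (hcount : ∀ w : Circle,
      ((univ.filter fun j => ‖(z j : ℂ) - w‖ ≤ 1 / n).card : ℝ) ≤ c * m / n)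
    (hupper : ∀ q : ℂ[X], q.natDegree ≤ n →
      circleLpPow p q ≤ C / m * ∑ j, ‖q.eval (z j : ℂ)‖ ^ p)
    (hδ0 : 0 ≤ δ) (hδ : δ ≤ 1 / 4)
    (hδK : 4 * (C * 2 ^ (p - 1) * (2 ^ p * ⌈7 / (1 / 2 : ℝ)⌉₊ * c)) * δ ≤ 1)
    (hnet : ∀ j, ∃ i, ‖(z j : ℂ) - x i‖ ≤ δ / n) {q : ℂ[X]} (hq : q.natDegree ≤ n) :
    circleLpPow p q ≤ C * 2 ^ p * c / n * ∑ i, ‖q.eval (x i : ℂ)‖ ^ p := by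
  classical
  have hp0 : 0 ≤ p := by linarith
  have hn0 : (0 : ℝ) < n := by exact_mod_cast hn
  have hm0 : (0 : ℝ) < m := by exact_mod_cast hm
  choose τ hτ using hnet
  choose y hyz hy using fun j => exists_norm_eval_sub_le q (z j) (x (τ j))
  set K := 2 ^ p * ⌈7 / (1 / 2 : ℝ)⌉₊ * c
  have hK : 0 ≤ K := by positivity
  set L := circleLpPow p q
  have hL : 0 ≤ L := circleLpPow_nonneg p q
  set s := ∑ i, ‖q.eval (x i : ℂ)‖ ^ p
  -- The mean value points `y j` depend on `q`, but stay within `2 * δ / n ≤ 1 / (2 * n)` of `z j`,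
  -- so at half the radius they inherit the count.
  have hycount : ∀ w : Circle,
      ((univ.filter fun j => ‖(y j : ℂ) - w‖ ≤ (1 / 2 : ℝ) / n).card : ℝ) ≤ c * m / n := by
    intro w
    refine le_trans (Nat.cast_le.2 (card_le_card fun j hj => ?_)) (hcount w)
    simp only [mem_filter, mem_univ, true_and] at hj ⊢
    have h1 := norm_sub_le_norm_sub_add_norm_sub (z j : ℂ) (y j) w
    have h2 := hyz j
    rw [norm_sub_rev] at h2
    have h3 : 2 * (δ / n) ≤ (1 / 2) / n := by
      rw [← mul_div_assoc]
      gcongr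
      linarith
    have h4 : (1 / 2 : ℝ) / n + (1 / 2) / n = 1 / n := by ring
    linarith [hτ j]
  have hdiff : ∑ j, ‖q.eval (z j : ℂ) - q.eval (x (τ j) : ℂ)‖ ^ p ≤ 2 * δ * K * m * L := by
    have h1 := sum_norm_eval_rpow_le hp y hn (by norm_num) (by norm_num) hycount
      ((natDegree_X_mul_derivative_le q).trans hq)
    have h2 : ∀ j, ‖q.eval (z j : ℂ) - q.eval (x (τ j) : ℂ)‖ ^ p ≤
        (2 * (δ / n)) ^ p * ‖(X * derivative q).eval (y j : ℂ)‖ ^ p := by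
      intro j
      rw [← Real.mul_rpow (by positivity) (norm_nonneg _)]
      refine Real.rpow_le_rpow (norm_nonneg _) ((hy j).trans ?_) hp0
      gcongr
      exact hτ j
    have h3 : (2 * δ) ^ p ≤ 2 * δ := by
      have := Real.rpow_le_rpow_of_exponent_ge' (by positivity : 0 ≤ 2 * δ) (by linarith)
        zero_le_one hp
      rwa [Real.rpow_one] at this
    calc _ ≤ ∑ j, (2 * (δ / n)) ^ p * ‖(X * derivative q).eval (y j : ℂ)‖ ^ p :=
          Finset.sum_le_sum fun j _ => h2 j
      _ = (2 * (δ / n)) ^ p * ∑ j, ‖(X * derivative q).eval (y j : ℂ)‖ ^ p := by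
          rw [Finset.mul_sum]
      _ ≤ (2 * (δ / n)) ^ p * (2 ^ p * ⌈7 / (1 / 2 : ℝ)⌉₊ * (c * m / n) * n *
            ((n : ℝ) ^ p * L)) := by
          refine mul_le_mul_of_nonneg_left (h1.trans ?_) (by positivity)
          exact mul_le_mul_of_nonneg_left (circleLpPow_X_mul_derivative_le hp hn hq)
            (by positivity)
      _ = (2 * δ) ^ p * K * m * L := by
          rw [← mul_div_assoc, Real.div_rpow (by positivity) hn0.le]
          have : (n : ℝ) ^ p ≠ 0 := by positivity
          simp only [K]
          field_simp
      _ ≤ _ := by gcongr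
  -- All `z j` assigned to one `x i` lie within `1 / n` of it, hence number at most `c * m / n`.
  have hfib : ∑ j, ‖q.eval (x (τ j) : ℂ)‖ ^ p ≤ c * m / n * s := by
    rw [← Finset.sum_fiberwise_of_maps_to (t := univ) (g := τ) (fun _ _ => mem_univ _),
      Finset.mul_sum]
    refine Finset.sum_le_sum fun i _ => ?_
    rw [Finset.sum_congr rfl (g := fun _ => ‖q.eval (x i : ℂ)‖ ^ p) fun j hj => by
      rw [(mem_filter.1 hj).2], sum_const, nsmul_eq_mul]
    refine mul_le_mul_of_nonneg_right (le_trans ?_ (hcount (x i))) (by positivity)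
    refine Nat.cast_le.2 (card_le_card fun j hj => ?_)
    simp only [mem_filter, mem_univ, true_and] at hj ⊢
    rw [← hj]
    refine (hτ j).trans ?_
    gcongr
    linarith
  have hsum : ∑ j, ‖q.eval (z j : ℂ)‖ ^ p ≤
      2 ^ (p - 1) * (2 * δ * K * m * L + c * m / n * s) := by
    refine le_trans ?_ (mul_le_mul_of_nonneg_left (add_le_add hdiff hfib) (by positivity))
    rw [← Finset.sum_add_distrib, Finset.mul_sum]
    refine Finset.sum_le_sum fun j _ => ?_
    refine le_trans (Real.rpow_le_rpow (norm_nonneg _) ?_ hp0)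
      (add_rpow_le_two_rpow_mul hp (norm_nonneg _) (norm_nonneg _))
    have := norm_add_le (q.eval (z j : ℂ) - q.eval (x (τ j) : ℂ)) (q.eval (x (τ j) : ℂ))
    rwa [sub_add_cancel] at this
  have h1 : L ≤ C * 2 ^ (p - 1) * K * 2 * δ * L + C * 2 ^ (p - 1) * c / n * s :=
    calc L ≤ C / m * ∑ j, ‖q.eval (z j : ℂ)‖ ^ p := hupper q hq
      _ ≤ C / m * (2 ^ (p - 1) * (2 * δ * K * m * L + c * m / n * s)) := by gcongr
      _ = _ := by field_simp
  -- By the choice of `δ` the coefficient of `L` on the right of `h1` is at most `1 / 2`; absorbing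
  -- it doubles the other term.
  have h2 : 4 * (C * 2 ^ (p - 1) * K) * δ * L ≤ 1 * L := by gcongr
  have h3 : C * 2 ^ p * c / n * s = 2 * (C * 2 ^ (p - 1) * c / n * s) := by
    rw [Real.rpow_sub_one two_ne_zero]
    ring
  rw [h3]
  linarith

/-- Two points in one arc of radius `δ / (3 * n)` would be closer than `δ / n`, so Plancherel-Polya
applies with at most one point per arc. -/
theorem sum_norm_eval_rpow_le_of_separated {p : ℝ} (hp : 1 ≤ p) {n : ℕ} (hn : 1 ≤ n)
    {κ : Type*} [Fintype κ] (x : κ → Circle) {δ : ℝ} (hδ0 : 0 < δ) (hδ : δ ≤ 1)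
    (hsep : ∀ j k, j ≠ k → δ / n ≤ ‖(x j : ℂ) - x k‖) {q : ℂ[X]} (hq : q.natDegree ≤ n) :
    ∑ i, ‖q.eval (x i : ℂ)‖ ^ p ≤ 2 ^ p * ⌈7 / (δ / 3)⌉₊ * n * circleLpPow p q := by
  have hn0 : (0 : ℝ) < n := by exact_mod_cast hn
  have h := sum_norm_eval_rpow_le hp x hn (ρ := δ / 3) (B := 1) (by positivity) (by linarith)
    (fun w => ?_) hq
  · simpa using h
  · rw [Nat.cast_le_one, card_le_one]
    intro a ha b hb
    simp only [mem_filter, mem_univ, true_and] at ha hb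
    by_contra hab
    have h1 := hsep a b hab
    have h2 := norm_sub_le_norm_sub_add_norm_sub (x a : ℂ) w (x b)
    rw [norm_sub_rev (w : ℂ)] at h2
    have h3 : δ / 3 / n = δ / n / 3 := by ring
    have h4 : 0 < δ / n := by positivity
    linarith

/-- Serves to exclude one-point generations. If the norm vanished, Plancherel-Polya at the antipode
`-x`, where the modulus is `2`, would be violated. -/
theorem circleLpPow_X_sub_C_pos {p : ℝ} (hp : 1 ≤ p) (x : Circle) :
    0 < circleLpPow p (X - C (x : ℂ)) := by
  refine (circleLpPow_nonneg _ _).lt_of_ne' fun h => ?_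
  have h1 := sum_norm_eval_rpow_le hp (ι := Unit) (fun _ => -x) (n := 1) le_rfl (ρ := 1) (B := 1)
    one_pos le_rfl (fun w => by
      rw [Nat.cast_le_one]
      exact (card_le_univ _).trans (by simp)) (natDegree_X_sub_C (x : ℂ)).le
  rw [h] at h1
  have h2 : ‖-(x : ℂ) - x‖ = 2 := by
    rw [← neg_add', norm_neg, ← two_mul, norm_mul, Circle.norm_coe]
    simp
  have h3 : ((-x : Circle) : ℂ) = -(x : ℂ) := rfl
  simp only [univ_unique, sum_singleton, eval_sub, eval_X, eval_C, h3, h2, mul_zero] at h1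
  have : (0 : ℝ) < 2 ^ p := by positivity
  linarith

/-! ### From normalization by degree to normalization by cardinality -/

/-- Sampling inequalities normalized by the degree yield sampling inequalities normalized by the
number of points. -/
theorem marcinkiewiczZygmund_of_degree_normalized {p : ℝ} (hp : 1 ≤ p) {n m : ℕ} (hn : 1 ≤ n)
    (x : Fin (m + 1) → Circle) {K₁ K₂ : ℝ} (hK₁ : 0 < K₁) (hK₂ : 0 < K₂)
    (h₁ : ∀ q : ℂ[X], q.natDegree ≤ n →
      ∑ i, ‖q.eval (x i : ℂ)‖ ^ p ≤ K₁ * n * circleLpPow p q)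
    (h₂ : ∀ q : ℂ[X], q.natDegree ≤ n →
      circleLpPow p q ≤ K₂ / n * ∑ i, ‖q.eval (x i : ℂ)‖ ^ p)
    {q : ℂ[X]} (hq : q.natDegree ≤ n) :
    (8 * K₁ * K₂)⁻¹ / m * ∑ i, ‖q.eval (x i : ℂ)‖ ^ p ≤ circleLpPow p q ∧
      circleLpPow p q ≤ 8 * K₁ * K₂ / m * ∑ i, ‖q.eval (x i : ℂ)‖ ^ p := by
  have hn0 : (0 : ℝ) < n := by exact_mod_cast hn
  -- With a single point, the polynomial vanishing there would have norm zero. Now `m + 1 ≤ 2 * m`,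
  -- so dividing by `m` instead of the true number of points is harmless.
  have hm : 1 ≤ m := by
    by_contra hm
    obtain rfl : m = 0 := by omega
    have h := h₂ (X - C (x 0 : ℂ)) (by rw [natDegree_X_sub_C]; exact hn)
    have hpos := circleLpPow_X_sub_C_pos hp (x 0)
    have hp0 : p ≠ 0 := by linarith
    simp [Real.zero_rpow hp0] at h
    linarith
  have hm1 : (1 : ℝ) ≤ m := by exact_mod_cast hm
  have hm0 : (0 : ℝ) < m := by linarith
  have hpi := Real.pi_gt_three
  have hpi4 := Real.pi_lt_four
  -- Testing both inequalities with `q = 1` makes `m` and `n` comparable.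
  have hup : (m : ℝ) ≤ 8 * K₁ * n := by
    have h := h₁ 1 (by simp)
    rw [circleLpPow_one] at h
    simp at h
    have : K₁ * n * (2 * Real.pi) ≤ K₁ * n * (2 * 4) := by gcongr
    linarith
  have hlow : (n : ℝ) ≤ 2 * K₂ * m := by
    have h := h₂ 1 (by simp)
    rw [circleLpPow_one] at h
    simp at h
    rw [div_mul_eq_mul_div, le_div_iff₀ hn0] at h
    have : K₂ * (m + 1) ≤ K₂ * (m + m) := by gcongr
    nlinarith
  have hL := circleLpPow_nonneg p q
  have hs : 0 ≤ ∑ i, ‖q.eval (x i : ℂ)‖ ^ p := Finset.sum_nonneg fun _ _ => by positivity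
  constructor
  · rw [div_mul_eq_mul_div, div_le_iff₀ hm0, inv_mul_le_iff₀ (by positivity)]
    calc _ ≤ K₁ * n * circleLpPow p q := h₁ q hq
      _ ≤ K₁ * (2 * K₂ * m) * circleLpPow p q := by gcongr
      _ ≤ 4 * (K₁ * (2 * K₂ * m) * circleLpPow p q) := by
          have : 0 ≤ K₁ * (2 * K₂ * m) * circleLpPow p q := by positivity
          linarith
      _ = _ := by ring
  · refine (h₂ q hq).trans (mul_le_mul_of_nonneg_right ?_ hs)
    rw [div_le_div_iff₀ hn0 hm0]
    calc K₂ * m ≤ K₂ * (8 * K₁ * n) := by gcongr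
      _ = _ := by ring

/-! ### Separated M-Z subfamilies for finite and infinite exponents -/

theorem TriangularFamily.IsMZFinite.exists_separated_subfamily {Z : TriangularFamily} {p : ℝ}
    (hp : 1 ≤ p) (hZ : Z.IsMZFinite p) :
    ∃ W : TriangularFamily, W.IsSubfamily Z ∧ W.IsSeparated ∧ W.IsMZFinite p := by
  obtain ⟨C, hC, h⟩ := hZ
  set c : ℝ := 16 * 4 ^ p * C with hcd
  have hc : 0 < c := by positivity
  set K : ℝ := C * 2 ^ (p - 1) * (2 ^ p * ⌈7 / (1 / 2 : ℝ)⌉₊ * c)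
  have hK : 0 < K := by
    have : 0 < ⌈7 / (1 / 2 : ℝ)⌉₊ := Nat.ceil_pos.2 (by norm_num)
    positivity
  set δ : ℝ := min (1 / 4) (1 / (4 * K)) with hδd
  have hδ0 : 0 < δ := by positivity
  have hδ4 : δ ≤ 1 / 4 := min_le_left _ _
  have hδK : 4 * K * δ ≤ 1 := by
    have := min_le_right (1 / 4) (1 / (4 * K))
    rwa [le_div_iff₀ (by positivity), mul_comm] at this
  obtain ⟨W, hWZ, hsep, hnet⟩ := Z.exists_separated_subfamily hδ0.le
  refine ⟨W, hWZ, ⟨δ, hδ0, fun n _ => hsep n⟩, ?_⟩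
  have hr : 0 < ⌈7 / (δ / 3)⌉₊ := Nat.ceil_pos.2 (by positivity)
  refine ⟨8 * (2 ^ p * ⌈7 / (δ / 3)⌉₊) * (C * 2 ^ p * c), by positivity, fun n hn q hq => ?_⟩
  have hn0 : (0 : ℝ) < n := by exact_mod_cast hn
  -- If `m_n = 0`, division by zero makes the upper bound `0`, whereas `q = 1` has norm `2π`.
  have hm : 1 ≤ Z.m n := by
    by_contra hm
    have h0 : (Z.m n : ℝ) = 0 := by exact_mod_cast (by omega : Z.m n = 0)
    have h1 := (h n hn 1 (by simp)).2
    rw [h0, div_zero, zero_mul] at h1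
    have h2 := circleLpPow_one p
    have h3 := Real.pi_pos
    rw [circleLpPow] at h2
    linarith
  have hm0 : (0 : ℝ) < Z.m n := by exact_mod_cast hm
  have hcount := card_filter_norm_sub_le hp (Z.point n) hn (A := C * Z.m n)
    (fun f hf => by
      have h1 := (h n hn f hf).1
      rwa [div_mul_eq_mul_div, div_le_iff₀ hm0, inv_mul_le_iff₀ hC, mul_comm _ (Z.m n : ℝ),
        ← mul_assoc] at h1) (by positivity)
  have hcount' : ∀ w : Circle,
      ((univ.filter fun j => ‖(Z.point n j : ℂ) - w‖ ≤ 1 / n).card : ℝ) ≤ c * Z.m n / n := by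
    intro w
    rw [hcd, mul_assoc]
    exact hcount w
  exact marcinkiewiczZygmund_of_degree_normalized hp hn (W.point n) (by positivity)
    (by positivity)
    (fun f hf => sum_norm_eval_rpow_le_of_separated hp hn _ hδ0 (by linarith) (hsep n) hf)
    (fun f hf => circleLpPow_le_of_net hp hn hm (Z.point n) (W.point n) hC hc hcount'
      (fun g hg => (h n hn g hg).2) hδ0.le hδ4 hδK (hnet n) hf) hq

theorem TriangularFamily.IsMZInfinite.exists_separated_subfamily {Z : TriangularFamily}
    (hZ : Z.IsMZInfinite) :
    ∃ W : TriangularFamily, W.IsSubfamily Z ∧ W.IsSeparated ∧ W.IsMZInfinite := by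
  obtain ⟨C, hC, h⟩ := hZ
  -- Chosen so that the Bernstein error `C * 2 * δ * M` equals `M / 2`.
  set δ : ℝ := 1 / (4 * C) with hδd
  have hδ0 : 0 < δ := by positivity
  obtain ⟨W, hWZ, hsep, hnet⟩ := Z.exists_separated_subfamily hδ0.le
  refine ⟨W, hWZ, ⟨δ, hδ0, fun n _ => hsep n⟩, 2 * C, by positivity, fun n q hq => ?_⟩
  set M := ⨆ z : Circle, ‖q.eval (z : ℂ)‖
  have hcont : Continuous fun z : Circle => ‖q.eval (z : ℂ)‖ :=
    (q.continuous.comp continuous_subtype_val).norm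
  have hbdd : BddAbove (Set.range fun z : Circle => ‖q.eval (z : ℂ)‖) :=
    (isCompact_range hcont).bddAbove
  have hM : ∀ z : Circle, ‖q.eval (z : ℂ)‖ ≤ M := le_ciSup hbdd
  have hM0 : 0 ≤ M := (norm_nonneg _).trans (hM 1)
  set s := ⨆ j, ‖q.eval (W.point n j : ℂ)‖
  have hs : ∀ j, ‖q.eval (Z.point n j : ℂ)‖ ≤ s + 2 * δ * M := by
    intro j
    obtain ⟨i, hi⟩ := hnet n j
    obtain ⟨y, -, hy⟩ := exists_norm_eval_sub_le q (Z.point n j) (W.point n i)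
    have h1 : ‖q.eval (W.point n i : ℂ)‖ ≤ s :=
      le_ciSup (f := fun i => ‖q.eval (W.point n i : ℂ)‖) (Set.finite_range _).bddAbove i
    have h2 := norm_sub_norm_le (q.eval (Z.point n j : ℂ)) (q.eval (W.point n i : ℂ))
    -- For `n = 0` the quotient `n / n` is `0`, so bounding it by `1` covers every generation.
    have h3 : 2 * ‖(Z.point n j : ℂ) - W.point n i‖ * ‖(X * derivative q).eval (y : ℂ)‖ ≤
        2 * δ * M :=
      calc _ ≤ 2 * (δ / n) * (n * M) := by
            gcongr
            exact norm_X_mul_derivative_eval_le hq hM y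
        _ = 2 * δ * M * (n / n) := by ring
        _ ≤ 2 * δ * M := mul_le_of_le_one_right (by positivity) (div_self_le_one _)
    linarith
  have h1 : M ≤ C * (s + 2 * δ * M) :=
    (h n q hq).trans (mul_le_mul_of_nonneg_left (ciSup_le hs) hC.le)
  have h2 : C * (s + 2 * δ * M) = C * s + M / 2 := by
    rw [hδd]
    field_simp
    ring
  linarith

theorem theorem4 (p : ℝ≥0∞) (hp : 1 ≤ p) (Z : TriangularFamily) (hZ : Z.IsMZFamily p) :
    ∃ Z' : TriangularFamily, Z'.IsSubfamily Z ∧ Z'.IsSeparated ∧ Z'.IsMZFamily p := by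
  by_cases h : p = ∞
  · obtain ⟨W, h1, h2, h3⟩ := (hZ.2 h).exists_separated_subfamily
    exact ⟨W, h1, h2, fun h' => absurd h h', fun _ => h3⟩
  · have hp1 : 1 ≤ p.toReal := by
      rw [← ENNReal.toReal_one]
      exact ENNReal.toReal_mono h hp
    obtain ⟨W, h1, h2, h3⟩ := (hZ.1 h).exists_separated_subfamily hp1
    exact ⟨W, h1, h2, fun _ => h3, fun h' => absurd h' h⟩
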